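/- Let $d\ge 1$, let $\mathcal X=X_1\times\dots\times X_d$ be a product of measurable spaces (for example $\mathbb R^d$), let $f:\mathcal X\to[0,1]$ be measurable, and let $\mathcal F$ (foreground) and $\mathcal B$ (background) be probability distributions on $\mathcal X$. For $x,z\in\mathcal X$ and $S\subseteq\{1,\dots,d\}$ let $r_S(z,x)\in\mathcal X$ be the point whose $i$-th coordinate is $x_i$ if $i\in S$ and $z_i$ otherwise. The local Shapley value of feature $k$ is $$\phi_k(f,x,z)=\frac1{d!}\sum_{\pi}\Big[f\big(r_{\pi_k\cup\{k\}}(z,x)\big)-f\big(r_{\pi_k}(z,x)\big)\Big],$$ where $\pi$ runs over the orderings of the $d$ features and $\pi_k$ is the set of features that precede $k$ in $\pi$. The global Shapley value (GSV) is $\Phi_k=\mathbb E_{x\sim\mathcal F,\,z\sim\mathcal B}[\phi_k(f,x,z)]$, with $x$ and $z$ independent. Given independent samples $S_0=(x^{(1)},\dots,x^{(M)})\sim\mathcal F^M$ and $S_1=(z^{(1)},\dots,z^{(M)})\sim\mathcal B^M$, the plug-in estimate $\widehat\Phi_k=\frac1{M^2}\sum_{i,j=1}^M\phi_k(f,x^{(i)},z^{(j)})$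 is the GSV in which $\mathcal F$ and $\mathcal B$ are replaced by the uniform distributions on the two samples. Put $$\sigma_{10}^2=\mathbb V_{x\sim\mathcal F}\big[\mathbb E_{z\sim\mathcal B}[\phi_k(f,x,z)]\big],\qquad \sigma_{01}^2=\mathbb V_{z\sim\mathcal B}\big[\mathbb E_{x\sim\mathcal F}[\phi_k(f,x,z)]\big].$$ Then for every $k=1,\dots,d$, as $M\to\infty$, $\sqrt M\,(\widehat\Phi_k-\Phi_k)$ converges in distribution to $N(0,\sigma_{10}^2+\sigma_{01}^2)$ (the point mass at $0$ if the variance is $0$). Moreover, if $\sigma_{10}^2+\sigma_{01}^2>0$, then for every $\delta\in(0,1)$ $$\lim_{M\to\infty}\mathbb P\left(|\widehat\Phi_k-\Phi_k|\ \ge\ \frac{F_{\mathcal N(0,1)}^{-1}(1-\delta/2)}{\sqrt M}\sqrt{\sigma_{10}^2+\sigma_{01}^2}\right)=\delta,$$ where $F_{\mathcal N(0,1)}^{-1}$ is the inverse of the cumulative distribution function of the standard normal distribution. -/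

import Mathlib

open MeasureTheory ProbabilityTheory Filter Topology

open scoped NNReal ENNReal

noncomputable section

namespace GlobalShapley

variable {d : ℕ} {X : Fin d → Type*}

/-- The replace function `r_S(z, x)`: the features in `S` are taken from the input `x`, all
others from the baseline `z`. -/
def replaceFeatures (S : Finset (Fin d)) (z x : ∀ i, X i) : ∀ i, X i :=
  fun i => if i ∈ S then x i else z i

/-- The features that appear before `i` in the ordering `π`; here `π j` is the position of the
feature `j`. -/
def before (π : Equiv.Perm (Fin d)) (i : Fin d) : Finset (Fin d) :=
  Finset.univ.filter fun j => π j < π i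

/-- The Local Shapley Value `φ_i(f, x, z)`: the average, over the `d!` orderings of the features,
of the change of the model output when feature `i` is activated. -/
def lsv (f : (∀ i, X i) → ℝ) (x z : ∀ i, X i) (i : Fin d) : ℝ :=
  (∑ π : Equiv.Perm (Fin d),
    (f (replaceFeatures (insert i (before π i)) z x) - f (replaceFeatures (before π i) z x)))
      / (d.factorial : ℝ)

variable [∀ i, MeasurableSpace (X i)]

/-- The Global Shapley Value `Φ_i(f, F, B)`: the expectation of `φ_i(f, x, z)` for independent
`x ∼ F` (foreground) and `z ∼ B` (background). -/
def gsv (f : (∀ i, X i) → ℝ) (F B : Measure (∀ i, X i)) (i : Fin d) : ℝ :=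
  ∫ p, lsv f p.1 p.2 i ∂(F.prod B)

/-- The categorical distribution `∑ⱼ ωⱼ δ(x⁽ʲ⁾)`. -/
def categorical {M : ℕ} (S : Fin M → ∀ i, X i) (ω : Fin M → ℝ≥0) : Measure (∀ i, X i) :=
  ∑ j, ω j • Measure.dirac (S j)

/-- The plug-in estimate: the GSV of the uniform distributions on the two samples. -/
def plugIn (f : (∀ i, X i) → ℝ) {M : ℕ} (S₀ S₁ : Fin M → ∀ i, X i) (i : Fin d) : ℝ :=
  gsv f (categorical S₀ fun _ => (M : ℝ≥0)⁻¹) (categorical S₁ fun _ => (M : ℝ≥0)⁻¹) i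

/-- The joint law of `(S₀, S₁)`: two independent samples `S₀ ∼ F^M`, `S₁ ∼ B^M`. -/
abbrev sampleLaw (F B : Measure (∀ i, X i)) [SigmaFinite F] [SigmaFinite B] (M : ℕ) :
    Measure ((Fin M → ∀ i, X i) × (Fin M → ∀ i, X i)) :=
  (Measure.pi fun _ : Fin M => F).prod (Measure.pi fun _ : Fin M => B)

/-- `σ₁₀²`, the variance over `x ∼ F` of `E_{z ∼ B} φ_i(f, x, z)`. -/
def sigmaSqForeground (f : (∀ i, X i) → ℝ) (F B : Measure (∀ i, X i)) (i : Fin d) : ℝ :=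
  variance (fun x => ∫ z, lsv f x z i ∂B) F

/-- `σ₀₁²`, the variance over `z ∼ B` of `E_{x ∼ F} φ_i(f, x, z)`. -/
def sigmaSqBackground (f : (∀ i, X i) → ℝ) (F B : Measure (∀ i, X i)) (i : Fin d) : ℝ :=
  variance (fun z => ∫ x, lsv f x z i ∂F) B

/-- The inverse of the cumulative distribution function of the standard normal law. -/
def stdNormalQuantile (p : ℝ) : ℝ :=
  sInf {t : ℝ | p ≤ cdf (gaussianReal 0 1) t}

theorem measurable_replaceFeatures (S : Finset (Fin d)) :
    Measurable fun p : (∀ i, X i) × (∀ i, X i) => replaceFeatures S p.2 p.1 := by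
  refine measurable_pi_lambda _ fun i => ?_
  by_cases h : i ∈ S
  · simp only [replaceFeatures, h, if_true]; fun_prop
  · simp only [replaceFeatures, h, if_false]; fun_prop

theorem measurable_lsv {f : (∀ i, X i) → ℝ} (hf : Measurable f) (i : Fin d) :
    Measurable fun p : (∀ i, X i) × (∀ i, X i) => lsv f p.1 p.2 i := by
  unfold lsv
  refine Measurable.div_const (Finset.measurable_sum _ fun π _ => ?_) _
  exact (hf.comp (measurable_replaceFeatures _)).sub (hf.comp (measurable_replaceFeatures _))

theorem plugIn_eq {f : (∀ i, X i) → ℝ} (hf : Measurable f) {M : ℕ}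
    (S₀ S₁ : Fin M → ∀ i, X i) (i : Fin d) :
    plugIn f S₀ S₁ i = 1 / (M : ℝ) ^ 2 * ∑ j, ∑ k, lsv f (S₀ j) (S₁ k) i := by
  have hm := (measurable_lsv hf i).stronglyMeasurable
  have key : (categorical S₀ fun _ => (M : ℝ≥0)⁻¹).prod (categorical S₁ fun _ => (M : ℝ≥0)⁻¹)
      = ∑ q : Fin M × Fin M, ((M : ℝ≥0)⁻¹ * (M : ℝ≥0)⁻¹) • Measure.dirac (S₀ q.1, S₁ q.2) := by
    simp only [categorical, ← Measure.sum_fintype]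
    rw [Measure.prod_sum]
    congr 1
    funext q
    rw [Measure.prod_smul_left, Measure.prod_smul_right, Measure.dirac_prod_dirac, smul_smul]
  have hint : ∀ q ∈ (Finset.univ : Finset (Fin M × Fin M)),
      Integrable (fun p : (∀ i, X i) × (∀ i, X i) => lsv f p.1 p.2 i)
        (((M : ℝ≥0)⁻¹ * (M : ℝ≥0)⁻¹) • Measure.dirac (S₀ q.1, S₁ q.2)) := fun q _ =>
    (integrable_dirac' hm (by simp)).smul_measure_nnreal
  unfold plugIn gsv
  rw [key, integral_finsetSum_measure hint]
  simp only [integral_smul_nnreal_measure, integral_dirac' _ _ hm]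
  rw [← Finset.smul_sum, Fintype.sum_prod_type, NNReal.smul_def, smul_eq_mul]
  congr 1
  push_cast
  ring

theorem cdf_stdNormalQuantile {p : ℝ} (hp : p ∈ Set.Ioo (0 : ℝ) 1) :
    cdf (gaussianReal 0 1) (stdNormalQuantile p) = p := by
  have hna : NullSingletonClass (gaussianReal 0 1) :=
    nullSingletonClass_gaussianReal one_ne_zero
  have hcont : Continuous (cdf (gaussianReal 0 1)) := by
    refine continuous_iff_continuousAt.2 fun x => ?_
    have h := (cdf (gaussianReal 0 1)).measure_singleton x
    rw [measure_cdf, measure_singleton] at h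
    have hle : cdf (gaussianReal 0 1) x ≤ Function.leftLim (cdf (gaussianReal 0 1)) x := by
      have := ENNReal.ofReal_eq_zero.1 h.symm
      linarith
    have hl : Function.leftLim (cdf (gaussianReal 0 1)) x = cdf (gaussianReal 0 1) x :=
      le_antisymm ((monotone_cdf _).leftLim_le le_rfl) hle
    refine (monotone_cdf _).continuousAt_iff_leftLim_eq_rightLim.2 ?_
    rw [hl, StieltjesFunction.rightLim_eq]
  obtain ⟨t, ht⟩ : ∃ t, cdf (gaussianReal 0 1) t = p :=
    mem_range_of_exists_le_of_exists_ge hcont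
      ((((tendsto_cdf_atBot _).eventually (gt_mem_nhds hp.1)).exists).imp fun _ h => h.le)
      ((((tendsto_cdf_atTop _).eventually (lt_mem_nhds hp.2)).exists).imp fun _ h => h.le)
  have hne : {t : ℝ | p ≤ cdf (gaussianReal 0 1) t}.Nonempty := ⟨t, ht.ge⟩
  have hbdd : BddBelow {t : ℝ | p ≤ cdf (gaussianReal 0 1) t} := by
    obtain ⟨a, ha⟩ := ((tendsto_cdf_atBot (gaussianReal 0 1)).eventually (gt_mem_nhds hp.1)).exists
    refine ⟨a, fun s hs => ?_⟩
    by_contra hlt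
    exact absurd (hs.trans (monotone_cdf _ (not_le.1 hlt).le)) (not_le.2 ha)
  have hcl : IsClosed {t : ℝ | p ≤ cdf (gaussianReal 0 1) t} :=
    isClosed_le continuous_const hcont
  refine le_antisymm ?_ (hcl.csInf_mem hne hbdd)
  exact (monotone_cdf _ (csInf_le hbdd ht.ge)).trans ht.le

end GlobalShapley

end

/-!
The local Shapley value of a feature is a bounded kernel `h x z`, since it averages differences of
two values in `[0, 1]`, and the plug-in estimate is its two-sample U-statistic
`M⁻² ∑ i, ∑ j, h (x i) (z j)`. The proof is Hoeffding's projection argument. Write `m` for the mean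
of `h`, `a x` and `b z` for its conditional means, and

  `h x z - m = (a x - m) + (b z - m) + r x z`,

where `r` (`doublyCentered`) has both conditional means zero.

Pairing `x i` with `z i` turns the first-order part into a sum of the independent, identically
distributed variables `a (x i) + b (z i)`, with variance the sum of the variances of `a` and `b`;
Mathlib's central limit theorem applies to it (`tendstoInDistribution_sum_add`). The terms
`r (x i) (z j)` are pairwise uncorrelated (`integral_sq_sum_sum`), so after multiplication by `√M`
the second-order part has second moment of order `1 / M` and vanishes in probability
(`tendstoInMeasure_of_centered`). Slutsky's theorem combines the two parts. It needs a single
probability space, for which an infinite sequence of independent pairs `(x i, z i)` is taken; its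
first `M` terms have the law of the two samples (`measurePreserving_splitPairs`).

For the tail probability, the two-sided tail event `{t | q √v ≤ |t|}` has a boundary of at most
two points, which is null for a normal law of positive variance. The portmanteau theorem then gives
convergence of its probability, and `measureReal_gaussianReal_quantile_le_abs` evaluates the limit.
-/

namespace GlobalShapley

/-! ### Second moment of a degenerate double sum -/

section TwoSample

variable {α β : Type*} [MeasurableSpace α] [MeasurableSpace β]

theorem measurable_sum_sum {h : α → β → ℝ} (hm : Measurable fun p : α × β => h p.1 p.2)
    (M : ℕ) :
    Measurable fun S : (Fin M → α) × (Fin M → β) => ∑ i, ∑ j, h (S.1 i) (S.2 j) :=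
  Finset.measurable_sum _ fun i _ => Finset.measurable_sum _ fun j _ =>
    hm.comp (f := fun S : (Fin M → α) × (Fin M → β) => (S.1 i, S.2 j)) (by fun_prop)

theorem abs_sum_sum_le {α β : Type*} {h : α → β → ℝ} {C : ℝ} (hC : ∀ x z, |h x z| ≤ C) (M : ℕ)
    (S : (Fin M → α) × (Fin M → β)) : |∑ i, ∑ j, h (S.1 i) (S.2 j)| ≤ M * (M * C) :=
  (Finset.abs_sum_le_sum_abs _ _).trans <| (Finset.sum_le_sum fun i _ =>
    (Finset.abs_sum_le_sum_abs _ _).trans <| Finset.sum_le_sum fun j _ =>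
      hC (S.1 i) (S.2 j)).trans (by simp)

/-- Centered independent terms are uncorrelated, so their second moments add. -/
theorem integral_sq_sum_pi {μ : Measure α} [IsProbabilityMeasure μ] {φ : α → ℝ}
    (hφ : MemLp φ 2 μ) (h0 : ∫ x, φ x ∂μ = 0) (M : ℕ) :
    ∫ x, (∑ i, φ (x i)) ^ 2 ∂(Measure.pi fun _ : Fin M => μ) = M * ∫ x, φ x ^ 2 ∂μ := by
  have hmem : ∀ i : Fin M, MemLp (fun x : Fin M → α => φ (x i)) 2 (Measure.pi fun _ => μ) :=
    fun i => hφ.comp_measurePreserving (measurePreserving_eval (fun _ => μ) i)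
  have hsum : ∫ x, (∑ i, fun y : Fin M → α => φ (y i)) x ∂(Measure.pi fun _ : Fin M => μ) = 0 := by
    simp only [Finset.sum_apply]
    rw [integral_finsetSum _ fun i _ => (hmem i).integrable one_le_two]
    refine Finset.sum_eq_zero fun i _ => ?_
    rw [integral_comp_eval (μ := fun _ : Fin M => μ) hφ.aestronglyMeasurable, h0]
  have hvar := variance_sum_pi (ι := Fin M) (μ := fun _ => μ) (X := fun _ => φ) fun _ => hφ
  rw [variance_of_integral_eq_zero
    (memLp_finsetSum' _ fun i _ => hmem i).aestronglyMeasurable.aemeasurable hsum] at hvar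
  simpa [variance_of_integral_eq_zero hφ.aestronglyMeasurable.aemeasurable h0] using hvar

variable (μ : Measure α) (ν : Measure β) [IsProbabilityMeasure μ] [IsProbabilityMeasure ν]

theorem memLp_of_abs_le {φ : α → ℝ} (hφ : Measurable φ) {C : ℝ} (hC : ∀ x, |φ x| ≤ C)
    (p : ℝ≥0∞) : MemLp φ p μ :=
  MemLp.of_bound hφ.aestronglyMeasurable C (ae_of_all _ hC)

/-- If both conditional means of the kernel vanish, the `M ^ 2` terms of the double sum are pairwise
uncorrelated, even those that share an index. The proof applies `integral_sq_sum_pi` to the first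
sample, with the second one fixed, and then to the second sample. -/
theorem integral_sq_sum_sum {h : α → β → ℝ} (hm : Measurable fun p : α × β => h p.1 p.2)
    {C : ℝ} (hC : ∀ x z, |h x z| ≤ C) (h₁ : ∀ z, ∫ x, h x z ∂μ = 0)
    (h₂ : ∀ x, ∫ z, h x z ∂ν = 0) (M : ℕ) :
    ∫ S, (∑ i, ∑ j, h (S.1 i) (S.2 j)) ^ 2
        ∂((Measure.pi fun _ : Fin M => μ).prod (Measure.pi fun _ : Fin M => ν)) =
      M ^ 2 * ∫ x, ∫ z, h x z ^ 2 ∂ν ∂μ := by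
  have hmx : ∀ z, Measurable fun x => h x z := fun z => hm.comp measurable_prodMk_right
  have hmz : ∀ x, Measurable fun z => h x z := fun x => hm.comp measurable_prodMk_left
  have hbd : ∀ x (z : Fin M → β), |∑ j, h x (z j)| ≤ M * C := fun x z =>
    (Finset.abs_sum_le_sum_abs _ _).trans <|
      (Finset.sum_le_sum fun j _ => hC x (z j)).trans (by simp)
  have hsum : Measurable fun S : α × (Fin M → β) => ∑ j, h S.1 (S.2 j) :=
    Finset.measurable_sum _ fun j _ =>
      hm.comp (f := fun S : α × (Fin M → β) => (S.1, S.2 j)) (by fun_prop)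
  -- Fubini: the inner integral is over the first sample, with the second one fixed
  rw [integral_prod_symm _ (memLp_of_abs_le _ (measurable_sum_sum hm M)
    (abs_sum_sum_le hC M) 2).integrable_sq]
  have hx : ∀ z : Fin M → β,
      ∫ x, (∑ i, ∑ j, h (x i) (z j)) ^ 2 ∂(Measure.pi fun _ : Fin M => μ) =
        M * ∫ x, (∑ j, h x (z j)) ^ 2 ∂μ := fun z => by
    refine integral_sq_sum_pi (φ := fun x => ∑ j, h x (z j))
      (memLp_of_abs_le _ (Finset.measurable_sum _ fun j _ => hmx (z j)) (fun x => hbd x z) 2) ?_ M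
    rw [integral_finsetSum _ fun j _ =>
      (memLp_of_abs_le μ (hmx (z j)) (fun x => hC x (z j)) 1).integrable le_rfl]
    simp [h₁]
  simp only [hx]
  rw [integral_const_mul, integral_integral_swap]
  · simp only [integral_sq_sum_pi (memLp_of_abs_le ν (hmz _) (hC _) 2) (h₂ _), integral_const_mul]
    ring
  · exact (memLp_of_abs_le ((Measure.pi fun _ : Fin M => ν).prod μ)
      (φ := fun q => ∑ j, h q.2 (q.1 j)) (hsum.comp measurable_swap)
      (fun q => hbd q.2 q.1) 2).integrable_sq

/-! ### Both samples on one probability space -/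

/-- The first `M` pairs of an infinite sequence of independent pairs, as a pair of samples. -/
def splitPairs (α β : Type*) (M : ℕ) (ω : ℕ → α × β) : (Fin M → α) × (Fin M → β) :=
  (fun i => (ω i).1, fun i => (ω i).2)

theorem measurePreserving_splitPairs (M : ℕ) :
    MeasurePreserving (splitPairs α β M) (Measure.infinitePi fun _ : ℕ => μ.prod ν)
      ((Measure.pi fun _ : Fin M => μ).prod (Measure.pi fun _ : Fin M => ν)) := by
  have h₁ : MeasurePreserving (fun (ω : ℕ → α × β) (i : Fin M) => ω i)
      (Measure.infinitePi fun _ : ℕ => μ.prod ν) (Measure.pi fun _ : Fin M => μ.prod ν) := by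
    refine ⟨by fun_prop, ?_⟩
    have hind : iIndepFun (fun (i : ℕ) (ω : ℕ → α × β) => ω i)
        (Measure.infinitePi fun _ : ℕ => μ.prod ν) :=
      iIndepFun_infinitePi (X := fun _ x => x) fun _ => measurable_id
    have := (iIndepFun_iff_map_fun_eq_pi_map fun i : Fin M =>
      (measurable_pi_apply (i : ℕ)).aemeasurable).1
      (hind.precomp (g := fun i : Fin M => (i : ℕ)) Fin.val_injective)
    rw [this]
    simp [Measure.infinitePi_map_eval]
  exact (measurePreserving_arrowProdEquivProdArrow α β (Fin M) (fun _ => μ) fun _ => ν).comp h₁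

/-! ### Hoeffding decomposition -/

/-- The second-order term of the Hoeffding decomposition of `h`: the kernel minus its two
conditional means, recentred so that both conditional means of the result vanish. -/
noncomputable def doublyCentered (h : α → β → ℝ) (x : α) (z : β) : ℝ :=
  h x z - ∫ z', h x z' ∂ν - ∫ x', h x' z ∂μ + ∫ p, h p.1 p.2 ∂(μ.prod ν)

theorem abs_integral_le_of_abs_le {φ : α → ℝ} {C : ℝ} (hC : ∀ x, |φ x| ≤ C) :
    |∫ x, φ x ∂μ| ≤ C := by
  have hC' : ∀ x, ‖φ x‖ ≤ C := hC
  simpa using norm_integral_le_of_norm_le_const (μ := μ) (ae_of_all _ hC')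

variable {h : α → β → ℝ} {C : ℝ}

theorem measurable_integral_left (hm : Measurable fun p : α × β => h p.1 p.2) :
    Measurable fun z => ∫ x, h x z ∂μ :=
  hm.stronglyMeasurable.integral_prod_left'.measurable

theorem measurable_integral_right (hm : Measurable fun p : α × β => h p.1 p.2) :
    Measurable fun x => ∫ z, h x z ∂ν :=
  hm.stronglyMeasurable.integral_prod_right'.measurable

theorem measurable_doublyCentered (hm : Measurable fun p : α × β => h p.1 p.2) :
    Measurable fun p : α × β => doublyCentered μ ν h p.1 p.2 :=
  ((hm.sub ((measurable_integral_right ν hm).comp measurable_fst)).sub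
    ((measurable_integral_left μ hm).comp measurable_snd)).add_const _

theorem abs_doublyCentered_le (hC : ∀ x z, |h x z| ≤ C) (x : α) (z : β) :
    |doublyCentered μ ν h x z| ≤ 4 * C := by
  have h₁ := abs_le.1 (hC x z)
  have h₂ := abs_le.1 (abs_integral_le_of_abs_le ν (hC x))
  have h₃ := abs_le.1 (abs_integral_le_of_abs_le μ fun x => hC x z)
  have h₄ := abs_le.1 (abs_integral_le_of_abs_le (μ.prod ν) fun p : α × β => hC p.1 p.2)
  exact abs_le.2 ⟨by unfold doublyCentered; linarith, by unfold doublyCentered; linarith⟩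

theorem integrable_kernel (hm : Measurable fun p : α × β => h p.1 p.2)
    (hC : ∀ x z, |h x z| ≤ C) : Integrable (fun p : α × β => h p.1 p.2) (μ.prod ν) :=
  (memLp_of_abs_le _ hm (fun p => hC p.1 p.2) 1).integrable le_rfl

theorem integral_doublyCentered_left (hm : Measurable fun p : α × β => h p.1 p.2)
    (hC : ∀ x z, |h x z| ≤ C) (z : β) : ∫ x, doublyCentered μ ν h x z ∂μ = 0 := by
  have hi : Integrable (fun x => h x z) μ :=
    (memLp_of_abs_le μ (hm.comp measurable_prodMk_right) (fun x => hC x z) 1).integrable le_rfl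
  have hint := integrable_kernel μ ν hm hC
  have ha : Integrable (fun x => ∫ z', h x z' ∂ν) μ := hint.integral_prod_left
  have hi₁ : Integrable (fun x => h x z - ∫ z', h x z' ∂ν) μ := hi.sub ha
  have hi₂ : Integrable (fun x => h x z - ∫ z', h x z' ∂ν - ∫ x', h x' z ∂μ) μ :=
    hi₁.sub (integrable_const _)
  unfold doublyCentered
  rw [integral_add hi₂ (integrable_const _), integral_sub hi₁ (integrable_const _),
    integral_sub hi ha, integral_prod _ hint]
  simp

theorem integral_doublyCentered_right (hm : Measurable fun p : α × β => h p.1 p.2)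
    (hC : ∀ x z, |h x z| ≤ C) (x : α) : ∫ z, doublyCentered μ ν h x z ∂ν = 0 := by
  have hi : Integrable (fun z => h x z) ν :=
    (memLp_of_abs_le ν (hm.comp measurable_prodMk_left) (hC x) 1).integrable le_rfl
  have hint := integrable_kernel μ ν hm hC
  have hb : Integrable (fun z => ∫ x', h x' z ∂μ) ν := hint.integral_prod_right
  have hi₁ : Integrable (fun z => h x z - ∫ z', h x z' ∂ν) ν := hi.sub (integrable_const _)
  have hi₂ : Integrable (fun z => h x z - ∫ z', h x z' ∂ν - ∫ x', h x' z ∂μ) ν := hi₁.sub hb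
  unfold doublyCentered
  rw [integral_add hi₂ (integrable_const _), integral_sub hi₁ hb,
    integral_sub hi (integrable_const _), integral_prod_symm _ hint]
  simp

/-! ### Asymptotic normality of two-sample U-statistics -/

/-- The U-statistic of a kernel with both conditional means zero is negligible at the scale `1 / √M`:
after multiplication by `√M` its second moment has order `1 / M`, so Chebyshev's inequality
applies. -/
theorem tendstoInMeasure_of_centered (hm : Measurable fun p : α × β => h p.1 p.2)
    (hC : ∀ x z, |h x z| ≤ C) (h₁ : ∀ z, ∫ x, h x z ∂μ = 0) (h₂ : ∀ x, ∫ z, h x z ∂ν = 0) :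
    TendstoInMeasure (Measure.infinitePi fun _ : ℕ => μ.prod ν)
      (fun (M : ℕ) (ω : ℕ → α × β) =>
        √(M : ℝ) / (M : ℝ) ^ 2 * ∑ i : Fin M, ∑ j : Fin M, h (ω i).1 (ω j).2) atTop 0 := by
  rw [tendstoInMeasure_iff_measureReal_norm]
  intro ε hε
  set s : ℝ := ∫ x, ∫ z, h x z ^ 2 ∂ν ∂μ with hs
  have hlim : Tendsto (fun M : ℕ => s / ε ^ 2 / (M : ℝ)) atTop (𝓝 0) :=
    tendsto_const_div_atTop_nhds_zero_nat _
  refine squeeze_zero' (Eventually.of_forall fun _ => measureReal_nonneg)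
    ((eventually_gt_atTop 0).mono fun M hM => ?_) hlim
  have hM' : (0 : ℝ) < M := by exact_mod_cast hM
  have hsp := measurePreserving_splitPairs μ ν M
  let R : (Fin M → α) × (Fin M → β) → ℝ :=
    fun S => √(M : ℝ) / (M : ℝ) ^ 2 * ∑ i, ∑ j, h (S.1 i) (S.2 j)
  have hRm : Measurable R := (measurable_sum_sum hm M).const_mul _
  have hR2 : ∫ ω, R (splitPairs α β M ω) ^ 2 ∂(Measure.infinitePi fun _ : ℕ => μ.prod ν) =
      s / M := by
    have h1 := integral_map (μ := Measure.infinitePi fun _ : ℕ => μ.prod ν)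
      (f := fun S => R S ^ 2) hsp.measurable.aemeasurable
      (hRm.pow_const 2).aestronglyMeasurable
    rw [hsp.map_eq] at h1
    rw [← h1]
    simp only [R, mul_pow]
    rw [integral_const_mul, integral_sq_sum_sum μ ν hm hC h₁ h₂, div_pow, Real.sq_sqrt hM'.le,
      ← hs]
    field_simp
  have hRint : Integrable (fun ω => R (splitPairs α β M ω) ^ 2)
      (Measure.infinitePi fun _ : ℕ => μ.prod ν) :=
    (((memLp_of_abs_le _ (measurable_sum_sum hm M) (abs_sum_sum_le hC M) 2).const_mul _)
      |>.comp_measurePreserving hsp).integrable_sq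
  have hcheb := mul_meas_ge_le_integral_of_nonneg (ae_of_all _ fun ω => sq_nonneg _) hRint
    (ε ^ 2)
  rw [hR2] at hcheb
  refine (measureReal_mono (s₂ := {ω | ε ^ 2 ≤ R (splitPairs α β M ω) ^ 2}) fun ω hω => ?_).trans ?_
  · simp only [Set.mem_ofPred_eq, Pi.zero_apply, sub_zero] at hω ⊢
    rw [← sq_abs (R _)]
    exact pow_le_pow_left₀ hε.le hω 2
  · rw [div_right_comm, le_div_iff₀ (by positivity), mul_comm]
    exact hcheb

/-- The central limit theorem for the first-order term of the Hoeffding decomposition: the two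
samples are merged into one sequence of independent, identically distributed pairs. -/
theorem tendstoInDistribution_sum_add {a : α → ℝ} {b : β → ℝ} (ham : Measurable a)
    (hbm : Measurable b) (ha : MemLp a 2 μ) (hb : MemLp b 2 ν) :
    TendstoInDistribution
      (fun (M : ℕ) (ω : ℕ → α × β) => (√(M : ℝ))⁻¹ *
        (∑ n ∈ Finset.range M, (a (ω n).1 + b (ω n).2) - M * (∫ x, a x ∂μ + ∫ z, b z ∂ν)))
      atTop (id : ℝ → ℝ) (fun _ => Measure.infinitePi fun _ : ℕ => μ.prod ν)
      (gaussianReal 0 (Var[a; μ] + Var[b; ν]).toNNReal) := by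
  let P : Measure (ℕ → α × β) := Measure.infinitePi fun _ : ℕ => μ.prod ν
  let Y : ℕ → (ℕ → α × β) → ℝ := fun n ω => a (ω n).1 + b (ω n).2
  have hg : Measurable fun p : α × β => a p.1 + b p.2 :=
    (ham.comp measurable_fst).add (hbm.comp measurable_snd)
  have heval : ∀ n, MeasurePreserving (fun ω : ℕ → α × β => ω n) P (μ.prod ν) := fun n =>
    measurePreserving_eval_infinitePi (fun _ : ℕ => μ.prod ν) n
  have hYlaw : ∀ n, P.map (Y n) = (μ.prod ν).map fun p => a p.1 + b p.2 := fun n => by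
    rw [← (heval n).map_eq, Measure.map_map hg (heval n).measurable]; rfl
  have hYm : ∀ n, Measurable (Y n) := fun n => hg.comp (heval n).measurable
  have hYL : MemLp (Y 0) 2 P :=
    (ha.comp_fst ν |>.add (hb.comp_snd μ)).comp_measurePreserving (heval 0)
  have hYvar : Var[Y 0; P] = Var[a; μ] + Var[b; ν] := by
    rw [← variance_add_prod ha hb]
    exact (heval 0).variance_fun_comp (f := fun p => a p.1 + b p.2) hg.aemeasurable
  have hYint : ∫ ω, Y 0 ω ∂P = ∫ x, a x ∂μ + ∫ z, b z ∂ν := by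
    have h0 : ∫ ω, Y 0 ω ∂P = ∫ p, (a p.1 + b p.2) ∂(μ.prod ν) := by
      rw [← (heval 0).map_eq, integral_map (heval 0).measurable.aemeasurable
        hg.aestronglyMeasurable]
    rw [h0, integral_add ((ha.integrable one_le_two).comp_fst ν)
      ((hb.integrable one_le_two).comp_snd μ), integral_fun_fst, integral_fun_snd]
    simp
  have hclt := tendstoInDistribution_inv_sqrt_mul_sum_sub (P := P) (X := Y) (Y := (id : ℝ → ℝ))
    (P' := gaussianReal 0 (Var[a; μ] + Var[b; ν]).toNNReal)
    (by rw [hYvar]; exact HasLaw.id) hYL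
    (iIndepFun_infinitePi (P := fun _ : ℕ => μ.prod ν) (X := fun _ p => a p.1 + b p.2)
      fun _ => hg)
    (fun n => ⟨(hYm n).aemeasurable, (hYm 0).aemeasurable, by rw [hYlaw, hYlaw]⟩)
  rw [hYint] at hclt
  exact hclt

/-- The Hoeffding decomposition of the two-sample U-statistic, multiplied by `√M`. For `M = 0` both
sides vanish, since `√0 = 0` and division by zero gives zero. -/
theorem sqrt_mul_twoSample_sub_projection (hm : Measurable fun p : α × β => h p.1 p.2)
    (hC : ∀ x z, |h x z| ≤ C) (M : ℕ) (ω : ℕ → α × β) :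
    √(M : ℝ) * (1 / (M : ℝ) ^ 2 * ∑ i : Fin M, ∑ j : Fin M, h (ω i).1 (ω j).2
        - ∫ p, h p.1 p.2 ∂(μ.prod ν)) -
      (√(M : ℝ))⁻¹ * (∑ n ∈ Finset.range M, (∫ z, h (ω n).1 z ∂ν + ∫ x, h x (ω n).2 ∂μ)
        - M * (∫ x, ∫ z, h x z ∂ν ∂μ + ∫ z, ∫ x, h x z ∂μ ∂ν)) =
      √(M : ℝ) / (M : ℝ) ^ 2 *
        ∑ i : Fin M, ∑ j : Fin M, doublyCentered μ ν h (ω i).1 (ω j).2 := by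
  have hint := integrable_kernel μ ν hm hC
  rw [← integral_prod _ hint, ← integral_prod_symm _ hint]
  set m := ∫ p, h p.1 p.2 ∂(μ.prod ν) with hmdef
  rcases Nat.eq_zero_or_pos M with rfl | hM
  · simp
  have hM' : (0 : ℝ) < M := by exact_mod_cast hM
  have hs : √(M : ℝ) * √(M : ℝ) = M := Real.mul_self_sqrt hM'.le
  have hs0 : √(M : ℝ) ≠ 0 := (Real.sqrt_pos.2 hM').ne'
  have hi : (√(M : ℝ))⁻¹ = √(M : ℝ) / M := by field_simp; rw [sq, hs]
  rw [hi, Finset.sum_range, Finset.sum_add_distrib]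
  simp only [doublyCentered, ← hmdef, Finset.sum_add_distrib, Finset.sum_sub_distrib,
    Finset.sum_const, Finset.card_univ, Fintype.card_fin, nsmul_eq_mul, ← Finset.mul_sum]
  field_simp
  ring

/-- A two-sample U-statistic with a bounded kernel is asymptotically normal. If both conditional
means of the kernel are constant, the limit is the point mass at `0`. -/
theorem tendstoInDistribution_twoSample (hm : Measurable fun p : α × β => h p.1 p.2)
    (hC : ∀ x z, |h x z| ≤ C) :
    TendstoInDistribution
      (fun (M : ℕ) (S : (Fin M → α) × (Fin M → β)) =>
        √(M : ℝ) * (1 / (M : ℝ) ^ 2 * ∑ i, ∑ j, h (S.1 i) (S.2 j) - ∫ p, h p.1 p.2 ∂(μ.prod ν)))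
      atTop (id : ℝ → ℝ)
      (fun M => (Measure.pi fun _ : Fin M => μ).prod (Measure.pi fun _ : Fin M => ν))
      (gaussianReal 0
        (Var[fun x => ∫ z, h x z ∂ν; μ] + Var[fun z => ∫ x, h x z ∂μ; ν]).toNNReal) := by
  have ham := measurable_integral_right ν hm
  have hbm := measurable_integral_left μ hm
  have hclt := tendstoInDistribution_sum_add μ ν ham hbm
    (memLp_of_abs_le μ ham (fun x => abs_integral_le_of_abs_le ν (hC x)) 2)
    (memLp_of_abs_le ν hbm (fun z => abs_integral_le_of_abs_le μ fun x => hC x z) 2)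
  have hrem := tendstoInMeasure_of_centered μ ν (measurable_doublyCentered μ ν hm)
    (abs_doublyCentered_le μ ν hC) (integral_doublyCentered_left μ ν hm hC)
    (integral_doublyCentered_right μ ν hm hC)
  simp only [← sqrt_mul_twoSample_sub_projection μ ν hm hC] at hrem
  have hsp := measurePreserving_splitPairs μ ν
  set T : (M : ℕ) → (Fin M → α) × (Fin M → β) → ℝ := fun M S =>
    √(M : ℝ) * (1 / (M : ℝ) ^ 2 * ∑ i, ∑ j, h (S.1 i) (S.2 j) - ∫ p, h p.1 p.2 ∂(μ.prod ν))
  have hT : ∀ M, Measurable (T M) := fun M =>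
    (((measurable_sum_sum hm M).const_mul _).sub_const _).const_mul _
  -- all sample sizes are realized on one probability space, where Slutsky's theorem applies
  have hlim := tendstoInDistribution_of_tendstoInMeasure_sub
    (fun M ω => T M (splitPairs α β M ω)) _ hclt hrem
    fun M => ((hT M).comp (hsp M).measurable).aemeasurable
  refine ⟨fun M => (hT M).aemeasurable, aemeasurable_id,
    hlim.tendsto.congr fun M => Subtype.ext ?_⟩
  change (Measure.infinitePi fun _ : ℕ => μ.prod ν).map (T M ∘ splitPairs α β M) =
    ((Measure.pi fun _ : Fin M => μ).prod (Measure.pi fun _ : Fin M => ν)).map (T M)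
  rw [← Measure.map_map (hT M) (hsp M).measurable, (hsp M).map_eq]

end TwoSample

/-! ### Two-sided tails of the normal law -/

section Gaussian

theorem measureReal_gaussianReal_Ici (q : ℝ) :
    (gaussianReal 0 1).real (Set.Ici q) = 1 - cdf (gaussianReal 0 1) q := by
  have : NullSingletonClass (gaussianReal 0 1) := nullSingletonClass_gaussianReal one_ne_zero
  rw [← measureReal_congr Ioi_ae_eq_Ici, ← Set.compl_Iic,
    probReal_compl_eq_one_sub measurableSet_Iic, cdf_eq_real]

/-- The standard normal law is symmetric and has no atoms. -/
theorem cdf_gaussianReal_neg (q : ℝ) :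
    cdf (gaussianReal 0 1) (-q) = 1 - cdf (gaussianReal 0 1) q := by
  have hmap : (gaussianReal 0 1).map (fun x : ℝ => -x) = gaussianReal 0 1 := by
    rw [gaussianReal_map_neg, neg_zero]
  rw [← measureReal_gaussianReal_Ici, cdf_eq_real]
  conv_rhs => rw [← hmap]
  rw [map_measureReal_apply (by fun_prop) measurableSet_Ici]
  congr 1
  ext t
  simp

/-- Positivity of the quantile makes the two tails at levels `±q` disjoint. -/
theorem stdNormalQuantile_pos {p : ℝ} (hp : p ∈ Set.Ioo (1 / 2 : ℝ) 1) :
    0 < stdNormalQuantile p := by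
  by_contra! hq
  have h₁ := cdf_stdNormalQuantile (p := p) ⟨by linarith [hp.1], hp.2⟩
  have h₂ := monotone_cdf (gaussianReal 0 1) (show stdNormalQuantile p ≤ -stdNormalQuantile p by
    linarith)
  rw [cdf_gaussianReal_neg, h₁] at h₂
  linarith [hp.1]

theorem measureReal_gaussianReal_le_abs {q : ℝ} (hq : 0 < q) :
    (gaussianReal 0 1).real {t | q ≤ |t|} = 2 * (1 - cdf (gaussianReal 0 1) q) := by
  have hset : {t : ℝ | q ≤ |t|} = Set.Iic (-q) ∪ Set.Ici q := by
    ext t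
    simp [le_abs', or_comm]
  have hdisj : Disjoint (Set.Iic (-q)) (Set.Ici q) :=
    Set.Iic_disjoint_Ici.2 (by linarith)
  rw [hset, measureReal_union hdisj measurableSet_Ici, measureReal_gaussianReal_Ici,
    ← cdf_eq_real, cdf_gaussianReal_neg]
  ring

theorem measureReal_gaussianReal_quantile_le_abs {v : ℝ} (hv : 0 < v) {δ : ℝ}
    (hδ : δ ∈ Set.Ioo (0 : ℝ) 1) :
    (gaussianReal 0 v.toNNReal).real {t | stdNormalQuantile (1 - δ / 2) * √v ≤ |t|} = δ := by
  have hp : 1 - δ / 2 ∈ Set.Ioo (1 / 2 : ℝ) 1 := ⟨by linarith [hδ.2], by linarith [hδ.1]⟩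
  have hs : 0 < √v := Real.sqrt_pos.2 hv
  have hmap : (gaussianReal 0 1).map (fun t => √v * t) = gaussianReal 0 v.toNNReal := by
    rw [gaussianReal_map_const_mul, mul_zero, mul_one]
    congr 1
    ext
    simp [Real.sq_sqrt hv.le, hv.le]
  rw [← hmap, map_measureReal_apply (by fun_prop)
    (measurableSet_le measurable_const measurable_abs)]
  have hset : (fun t => √v * t) ⁻¹' {t | stdNormalQuantile (1 - δ / 2) * √v ≤ |t|} =
      {t | stdNormalQuantile (1 - δ / 2) ≤ |t|} := by
    ext t
    simp [abs_mul, abs_of_pos hs, mul_comm (√v), hs]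
  rw [hset, measureReal_gaussianReal_le_abs (stdNormalQuantile_pos hp),
    cdf_stdNormalQuantile ⟨by linarith [hp.1], hp.2⟩]
  ring

end Gaussian

/-! ### The Shapley kernel and the plug-in estimate -/

theorem abs_lsv_le_one {d : ℕ} {X : Fin d → Type*} {f : (∀ i, X i) → ℝ}
    (hf01 : ∀ x, f x ∈ Set.Icc (0 : ℝ) 1) (x z : ∀ i, X i) (k : Fin d) : |lsv f x z k| ≤ 1 := by
  have hd : (0 : ℝ) < d.factorial := by exact_mod_cast d.factorial_pos
  rw [lsv, abs_div, abs_of_pos hd, div_le_one hd]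
  refine (Finset.abs_sum_le_sum_abs _ _).trans <| (Finset.sum_le_sum fun π _ =>
    abs_sub_le_of_le_of_le (hf01 _).1 (hf01 _).2 (hf01 _).1 (hf01 _).2).trans ?_
  simp [Fintype.card_perm]

end GlobalShapley

theorem mainTheorem4 {d : ℕ} {X : Fin d → Type*} [∀ i, MeasurableSpace (X i)]
    (f : (∀ i, X i) → ℝ) (hf : Measurable f) (hf01 : ∀ x, f x ∈ Set.Icc (0 : ℝ) 1)
    (F B : Measure (∀ i, X i)) [IsProbabilityMeasure F] [IsProbabilityMeasure B] (k : Fin d) :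
    TendstoInDistribution
        (fun (M : ℕ) (S : (Fin M → ∀ i, X i) × (Fin M → ∀ i, X i)) =>
          √(M : ℝ) * (GlobalShapley.plugIn f S.1 S.2 k - GlobalShapley.gsv f F B k))
        atTop (id : ℝ → ℝ) (fun M => GlobalShapley.sampleLaw F B M)
        (gaussianReal 0 (GlobalShapley.sigmaSqForeground f F B k +
          GlobalShapley.sigmaSqBackground f F B k).toNNReal) ∧
      (0 < GlobalShapley.sigmaSqForeground f F B k + GlobalShapley.sigmaSqBackground f F B k →
        ∀ δ ∈ Set.Ioo (0 : ℝ) 1,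
          Tendsto
            (fun M : ℕ => (GlobalShapley.sampleLaw F B M).real
              {S | GlobalShapley.stdNormalQuantile (1 - δ / 2) / √(M : ℝ) *
                    √(GlobalShapley.sigmaSqForeground f F B k +
                      GlobalShapley.sigmaSqBackground f F B k) ≤
                  |GlobalShapley.plugIn f S.1 S.2 k - GlobalShapley.gsv f F B k|})
            atTop (𝓝 δ)) := by
  have hclt : TendstoInDistribution
      (fun (M : ℕ) (S : (Fin M → ∀ i, X i) × (Fin M → ∀ i, X i)) =>
        √(M : ℝ) * (GlobalShapley.plugIn f S.1 S.2 k - GlobalShapley.gsv f F B k))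
      atTop (id : ℝ → ℝ) (fun M => GlobalShapley.sampleLaw F B M)
      (gaussianReal 0 (GlobalShapley.sigmaSqForeground f F B k +
        GlobalShapley.sigmaSqBackground f F B k).toNNReal) := by
    simp only [GlobalShapley.plugIn_eq hf]
    exact GlobalShapley.tendstoInDistribution_twoSample F B
      (h := fun x z => GlobalShapley.lsv f x z k) (GlobalShapley.measurable_lsv hf k)
      fun x z => GlobalShapley.abs_lsv_le_one hf01 x z k
  refine ⟨hclt, fun hv δ hδ => ?_⟩
  set v := GlobalShapley.sigmaSqForeground f F B k + GlobalShapley.sigmaSqBackground f F B k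
  set q := GlobalShapley.stdNormalQuantile (1 - δ / 2)
  have : NullSingletonClass (gaussianReal 0 v.toNNReal) :=
    nullSingletonClass_gaussianReal (Real.toNNReal_pos.2 hv).ne'
  have hE : MeasurableSet {t : ℝ | q * √v ≤ |t|} := measurableSet_le (by fun_prop) (by fun_prop)
  -- the boundary of the two-sided tail event has at most two points
  have hfr : gaussianReal 0 v.toNNReal (frontier {t : ℝ | q * √v ≤ |t|}) = 0 := by
    refine measure_mono_null (t := {q * √v, -(q * √v)})
      ((frontier_le_subset_eq continuous_const continuous_abs).trans fun t ht => ?_)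
      (Set.Finite.measure_zero (by simp) _)
    rcases abs_choice t with h | h <;> simp_all
  have hlim := ProbabilityMeasure.tendsto_measure_of_null_frontier_of_tendsto' hclt.tendsto
    (E := {t : ℝ | q * √v ≤ |t|}) (by simpa using hfr)
  simp only [ProbabilityMeasure.coe_mk, Measure.map_id] at hlim
  have hlim' := (ENNReal.tendsto_toReal
    (measure_ne_top (gaussianReal 0 v.toNNReal) {t : ℝ | q * √v ≤ |t|})).comp hlim
  change Tendsto _ _ (𝓝 ((gaussianReal 0 v.toNNReal).real {t : ℝ | q * √v ≤ |t|})) at hlim'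
  rw [GlobalShapley.measureReal_gaussianReal_quantile_le_abs hv hδ] at hlim'
  refine hlim'.congr' ((eventually_gt_atTop 0).mono fun M hM => ?_)
  have hs : 0 < √(M : ℝ) := Real.sqrt_pos.2 (by exact_mod_cast hM)
  simp only [Function.comp_apply, Measure.real]
  rw [Measure.map_apply_of_aemeasurable (hclt.forall_aemeasurable M) hE]
  congr 2
  ext S
  simp only [Set.mem_preimage, Set.mem_ofPred_eq, abs_mul, abs_of_pos hs]
  rw [div_mul_eq_mul_div, div_le_iff₀' hs]
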